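/- For a real number $\alpha$ and an integer $n\ge 0$ let $L_n^{\alpha}(x)=\sum_{i=0}^{n}(-1)^i\binom{n+\alpha}{n-i}\frac{x^i}{i!}$ be the generalized Laguerre polynomial (with the generalized binomial coefficient $\binom{a}{m}=a(a-1)\cdots(a-m+1)/m!$), and let $L_n=L_n^0$. Let $J_m$ be the Bessel function of the first kind of integer order $m$, that is, $J_m(x)=\sum_{j\ge 0}\frac{(-1)^j}{j!\,(j+m)!}\left(\frac{x}{2}\right)^{2j+m}$ for $m\ge 0$ and $J_{-m}=(-1)^mJ_m$. For all nonzero real numbers $s,t$ and every integer $n\ge 0$, the series below converges absolutely and $$\frac{1}{2\pi}\int_0^{2\pi} e^{-st\cos\theta}\,L_n(s^2+t^2+2st\cos\theta)\,d\theta=\frac{n!}{(st)^n}\sum_{k=0}^{\infty}\frac{(st)^k}{k!}\,L_n^{k-n}(s^2)\,L_n^{k-n}(t^2)\,J_{k-n}(st).$$ -/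

import Mathlib

/-- The generalized Laguerre polynomial `L_n^α(x) = ∑_{i ≤ n} (-1)^i C(n + α, n - i) x^i / i!`,
for an arbitrary real parameter `α` (negative integers included). `Ring.choose a m` is the
generalized binomial coefficient `a (a - 1) ⋯ (a - m + 1) / m!`. -/
noncomputable def genLaguerre (n : ℕ) (α x : ℝ) : ℝ :=
  ∑ i ∈ Finset.range (n + 1),
    (-1) ^ i * Ring.choose ((n : ℝ) + α) (n - i) * x ^ i / (Nat.factorial i : ℝ)

/-- The Laguerre polynomial `L_n = L_n^0`. -/
noncomputable def laguerre (n : ℕ) (x : ℝ) : ℝ :=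
  genLaguerre n 0 x

/-- The Bessel function of the first kind of order `m : ℕ`,
`J_m(x) = ∑_j (-1)^j / (j! (j + m)!) (x / 2)^(2 j + m)`. -/
noncomputable def besselJNat (m : ℕ) (x : ℝ) : ℝ :=
  ∑' j : ℕ, (-1) ^ j / ((Nat.factorial j : ℝ) * (Nat.factorial (j + m) : ℝ)) *
    (x / 2) ^ (2 * j + m)

/-- The series that defines `besselJNat` converges everywhere. -/
theorem summable_besselJNat (m : ℕ) (x : ℝ) :
    Summable fun j : ℕ =>
      (-1) ^ j / ((Nat.factorial j : ℝ) * (Nat.factorial (j + m) : ℝ)) *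
        (x / 2) ^ (2 * j + m) := by
  refine Summable.of_norm_bounded
    (g := fun j : ℕ => |x / 2| ^ m * (((x / 2) ^ 2) ^ j / (Nat.factorial j : ℝ)))
    ((Real.summable_pow_div_factorial _).mul_left _) fun j => ?_
  have h1 : (1 : ℝ) ≤ (Nat.factorial (j + m) : ℝ) := by
    exact_mod_cast Nat.succ_le_of_lt (Nat.factorial_pos _)
  have h0 : (0 : ℝ) < (Nat.factorial j : ℝ) := by exact_mod_cast Nat.factorial_pos _
  rw [norm_mul, norm_div, norm_pow, norm_neg, norm_one, one_pow, norm_pow, Real.norm_eq_abs,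
    Real.norm_eq_abs, abs_of_pos (by positivity : (0 : ℝ) < _ * _), pow_add, pow_mul, sq_abs]
  have h2 : 1 / ((Nat.factorial j : ℝ) * (Nat.factorial (j + m) : ℝ))
      ≤ 1 / (Nat.factorial j : ℝ) := by
    apply one_div_le_one_div_of_le h0
    nlinarith
  calc _ ≤ 1 / (Nat.factorial j : ℝ) * (((x / 2) ^ 2) ^ j * |x / 2| ^ m) := by gcongr
    _ = _ := by ring

/-- The Bessel function of the first kind of integer order, with `J_{-m} = (-1)^m J_m`. -/
noncomputable def besselJ : ℤ → ℝ → ℝ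
  | Int.ofNat m, x => besselJNat m x
  | Int.negSucc m, x => (-1) ^ (m + 1) * besselJNat (m + 1) x

/-! Since `L_n^{k-n}(x)` is the `X^n` coefficient of `(1+X)^k e^{-xX}`, the sum over `k` of `w^k/k!
L_n^{k-n}(x) L_n^{k-n}(y)` has a closed form: `e^w` times a finite sum in `w` and `(w-x)(w-y)`
(`hasSum_laguerreCoeff_mul`). Put `z = st`, `x = s²`, `y = t²` and `w = z/u` with `u = -e^{iθ}`.
Then `-(w-x)(w-y)/w = s² + t² - z(u + 1/u) = s² + t² + 2st cos θ`, so the finite sum is `w^n/n!`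
times `L_n` at that point (`laguerre_eq_sum`). Multiply by `u^n e^{z(u-1/u)/2}` and integrate over
`θ`. In the closed form the exponentials combine to `e^{z(u+1/u)/2} = e^{-z cos θ}`; in the series,
the `k`-th term acquires the integral of `u^{n-k} e^{z(u-1/u)/2}`, which is `2π J_{k-n}(z)`
(`integral_eq_besselJ`). -/

/-! ### Generating functions of the polynomials `L_n^{k-n}`. -/

/-- The series `∑ a^i / i! X^i`. -/
noncomputable def expSeries (a : ℂ) : PowerSeries ℂ :=
  PowerSeries.mk fun i => a ^ i / (Nat.factorial i : ℂ)

/-- The series `∑ C(k, q) X^q = (1 + X)^k`. -/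
noncomputable def binomSeries (k : ℕ) : PowerSeries ℂ :=
  PowerSeries.mk fun q => (Nat.choose k q : ℂ)

/-- The coefficient of `X^n` in `(1 + X)^k exp(-x X)`; this is `L_n^{k - n}(x)`. -/
noncomputable def laguerreCoeff (n : ℕ) (x : ℂ) (k : ℕ) : ℂ :=
  PowerSeries.coeff n (expSeries (-x) * binomSeries k)

theorem laguerreCoeff_eq (n : ℕ) (x : ℂ) (k : ℕ) :
    laguerreCoeff n x k = ∑ p ∈ Finset.HasAntidiagonal.antidiagonal n,
      (-x) ^ p.1 / (Nat.factorial p.1 : ℂ) * (Nat.choose k p.2 : ℂ) := by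
  simp [laguerreCoeff, expSeries, binomSeries, PowerSeries.coeff_mul]

theorem expSeries_mul (a b : ℂ) : expSeries a * expSeries b = expSeries (a + b) := by
  ext n
  simp only [expSeries, PowerSeries.coeff_mul, PowerSeries.coeff_mk]
  rw [add_pow, Finset.sum_div, Finset.Nat.sum_antidiagonal_eq_sum_range_succ_mk]
  refine Finset.sum_congr rfl fun i hi => ?_
  have hi' : i ≤ n := Nat.lt_succ_iff.mp (Finset.mem_range.mp hi)
  rw [Nat.cast_choose ℂ hi']
  have h1 := Nat.factorial_ne_zero n
  have h2 := Nat.factorial_ne_zero i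
  have h3 := Nat.factorial_ne_zero (n - i)
  field_simp

theorem binomSeries_add (m p : ℕ) : binomSeries (m + p) = binomSeries p * binomSeries m := by
  ext n
  simp only [binomSeries, PowerSeries.coeff_mul, PowerSeries.coeff_mk]
  rw [add_comm, Nat.add_choose_eq]
  push_cast
  rfl

theorem laguerreCoeff_add (n : ℕ) (x : ℂ) (m p : ℕ) :
    laguerreCoeff n x (m + p) = ∑ q ∈ Finset.HasAntidiagonal.antidiagonal n,
      (Nat.choose p q.1 : ℂ) * laguerreCoeff q.2 x m := by
  rw [laguerreCoeff, binomSeries_add, mul_left_comm, PowerSeries.coeff_mul]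
  simp [laguerreCoeff, binomSeries]

/-- Weighting an exponential sum by `C(k, p)` shifts the summation index by `p`. -/
theorem hasSum_choose_mul {w S : ℂ} {p : ℕ} {f : ℕ → ℂ}
    (h : HasSum (fun m => w ^ m / (Nat.factorial m : ℂ) * f (m + p)) S) :
    HasSum (fun k => w ^ k / (Nat.factorial k : ℂ) * ((Nat.choose k p : ℂ) * f k))
      (w ^ p / (Nat.factorial p : ℂ) * S) := by
  -- The terms with `k < p` vanish because `C(k, p) = 0`.
  rw [← hasSum_nat_add_iff' p, Finset.sum_eq_zero, sub_zero]
  · refine (h.mul_left _).congr_fun fun m => ?_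
    rw [Nat.cast_choose ℂ (Nat.le_add_left p m), Nat.add_sub_cancel]
    have h1 := Nat.factorial_ne_zero m
    have h2 := Nat.factorial_ne_zero p
    have h3 := Nat.factorial_ne_zero (m + p)
    field_simp
    ring
  · intro i hi
    simp [Nat.choose_eq_zero_of_lt (Finset.mem_range.mp hi)]

theorem hasSum_pow_div_factorial (w : ℂ) :
    HasSum (fun k => w ^ k / (Nat.factorial k : ℂ)) (Complex.exp w) := by
  rw [Complex.exp_eq_exp_ℂ]
  exact NormedSpace.expSeries_div_hasSum_exp w

/-- Summing `w^k/k! (1+X)^k` gives `e^w e^{wX}`; the factor `e^{-xX}` turns this into `e^w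
e^{(w-x)X}`. -/
theorem hasSum_laguerreCoeff (n : ℕ) (w x : ℂ) :
    HasSum (fun k => w ^ k / (Nat.factorial k : ℂ) * laguerreCoeff n x k)
      (Complex.exp w * ((w - x) ^ n / (Nat.factorial n : ℂ))) := by
  have h : (w - x) ^ n / (Nat.factorial n : ℂ) = ∑ p ∈ Finset.HasAntidiagonal.antidiagonal n,
      (-x) ^ p.1 / (Nat.factorial p.1 : ℂ) * (w ^ p.2 / (Nat.factorial p.2 : ℂ)) := by
    have := congrArg (PowerSeries.coeff n) (expSeries_mul (-x) w)
    simp only [expSeries, PowerSeries.coeff_mul, PowerSeries.coeff_mk] at this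
    rw [this, neg_add_eq_sub]
  rw [h, Finset.mul_sum]
  simp only [laguerreCoeff_eq, Finset.mul_sum]
  refine hasSum_sum fun q _ => ?_
  have := (hasSum_choose_mul (p := q.2) (f := fun _ => 1)
    (by simpa using hasSum_pow_div_factorial w)).mul_left
      ((-x) ^ q.1 / (Nat.factorial q.1 : ℂ))
  rw [mul_comm (Complex.exp w), mul_assoc]
  refine this.congr_fun fun k => ?_
  ring

/-- Weighting the coefficients of `e^{wX}` by `C(p, j)` produces `(wX)^j/j! e^{wX}`; multiply by
`e^{-xX}` and compare coefficients. -/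
theorem sum_antidiagonal_choose (j N : ℕ) (w x : ℂ) :
    ∑ p ∈ Finset.HasAntidiagonal.antidiagonal (j + N), (-x) ^ p.1 / (Nat.factorial p.1 : ℂ) *
      (w ^ p.2 / (Nat.factorial p.2 : ℂ) * (Nat.choose p.2 j : ℂ)) =
    w ^ j / (Nat.factorial j : ℂ) * ((w - x) ^ N / (Nat.factorial N : ℂ)) := by
  have h : (PowerSeries.mk fun p => w ^ p / (Nat.factorial p : ℂ) * (Nat.choose p j : ℂ)) =
      PowerSeries.X ^ j * (PowerSeries.C (w ^ j / (Nat.factorial j : ℂ)) * expSeries w) := by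
    ext p
    rw [PowerSeries.coeff_mk, PowerSeries.coeff_X_pow_mul']
    split_ifs with hp
    · obtain ⟨r, rfl⟩ := Nat.exists_eq_add_of_le hp
      rw [Nat.add_sub_cancel_left, PowerSeries.coeff_C_mul, expSeries, PowerSeries.coeff_mk,
        Nat.cast_choose ℂ hp, Nat.add_sub_cancel_left]
      have h1 := Nat.factorial_ne_zero j
      have h2 := Nat.factorial_ne_zero r
      have h3 := Nat.factorial_ne_zero (j + r)
      field_simp
      ring
    · simp [Nat.choose_eq_zero_of_lt (not_le.mp hp)]
  have h2 := congrArg (PowerSeries.coeff (j + N)) (congrArg (expSeries (-x) * ·) h)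
  rw [mul_left_comm, mul_left_comm (expSeries (-x)), expSeries_mul, add_comm j N,
    PowerSeries.coeff_X_pow_mul, PowerSeries.coeff_C_mul] at h2
  simp only [expSeries, PowerSeries.coeff_mul, PowerSeries.coeff_mk] at h2
  rw [add_comm j N, h2, neg_add_eq_sub]

/-- The bilinear generating function of the polynomials `L_n^{k - n}`, summed over `k`. -/
theorem hasSum_laguerreCoeff_mul (n : ℕ) (w x y : ℂ) :
    HasSum (fun k => w ^ k / (Nat.factorial k : ℂ) * (laguerreCoeff n x k * laguerreCoeff n y k))
      (Complex.exp w * ∑ q ∈ Finset.HasAntidiagonal.antidiagonal n, w ^ q.1 / (Nat.factorial q.1 : ℂ) *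
        ((w - x) ^ q.2 / (Nat.factorial q.2 : ℂ)) * ((w - y) ^ q.2 / (Nat.factorial q.2 : ℂ))) := by
  have key : HasSum
      (fun k => w ^ k / (Nat.factorial k : ℂ) * (laguerreCoeff n x k * laguerreCoeff n y k))
      (∑ p ∈ Finset.HasAntidiagonal.antidiagonal n, (-x) ^ p.1 / (Nat.factorial p.1 : ℂ) *
        (w ^ p.2 / (Nat.factorial p.2 : ℂ) * ∑ q ∈ Finset.HasAntidiagonal.antidiagonal n,
          (Nat.choose p.2 q.1 : ℂ) *
            (Complex.exp w * ((w - y) ^ q.2 / (Nat.factorial q.2 : ℂ))))) := by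
    -- Only the `x` factor is expanded; each binomial `C(k, p.2)` then shifts the index of the `y`
    -- factor, which `laguerreCoeff_add` (Vandermonde) resolves.
    simp only [laguerreCoeff_eq n x, Finset.mul_sum, Finset.sum_mul]
    refine hasSum_sum fun p _ => ?_
    have h1 : HasSum (fun m => w ^ m / (Nat.factorial m : ℂ) * laguerreCoeff n y (m + p.2))
        (∑ q ∈ Finset.HasAntidiagonal.antidiagonal n, (Nat.choose p.2 q.1 : ℂ) *
            (Complex.exp w * ((w - y) ^ q.2 / (Nat.factorial q.2 : ℂ)))) := by
      simp only [laguerreCoeff_add, Finset.mul_sum]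
      refine hasSum_sum fun q _ => ?_
      refine ((hasSum_laguerreCoeff q.2 w y).mul_left (Nat.choose p.2 q.1 : ℂ)).congr_fun
        fun m => ?_
      ring
    simp only [← Finset.mul_sum]
    refine ((hasSum_choose_mul h1).mul_left
      ((-x) ^ p.1 / (Nat.factorial p.1 : ℂ))).congr_fun fun k => ?_
    ring
  convert key using 1
  simp only [Finset.mul_sum]
  rw [Finset.sum_comm]
  refine Finset.sum_congr rfl fun q hq => ?_
  have := sum_antidiagonal_choose q.1 q.2 w x
  rw [Finset.HasAntidiagonal.mem_antidiagonal.mp hq] at this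
  rw [← this, Finset.sum_mul, Finset.mul_sum]
  refine Finset.sum_congr rfl fun p _ => ?_
  ring

theorem norm_laguerreCoeff_le (n : ℕ) (x : ℂ) :
    ∃ M, 0 ≤ M ∧ ∀ k, ‖laguerreCoeff n x k‖ ≤ M * 2 ^ k := by
  refine ⟨∑ p ∈ Finset.HasAntidiagonal.antidiagonal n, ‖(-x) ^ p.1 / (Nat.factorial p.1 : ℂ)‖,
    by positivity, fun k => ?_⟩
  rw [laguerreCoeff_eq, Finset.sum_mul]
  refine (norm_sum_le _ _).trans (Finset.sum_le_sum fun p _ => ?_)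
  rw [norm_mul, Complex.norm_natCast]
  gcongr
  exact_mod_cast Nat.choose_le_two_pow k p.2

theorem summable_norm_laguerreCoeff_mul (n : ℕ) (w x y : ℂ) :
    Summable fun k : ℕ =>
      ‖w ^ k / (Nat.factorial k : ℂ) * (laguerreCoeff n x k * laguerreCoeff n y k)‖ := by
  obtain ⟨M, hM, hx⟩ := norm_laguerreCoeff_le n x
  obtain ⟨M', hM', hy⟩ := norm_laguerreCoeff_le n y
  refine Summable.of_nonneg_of_le (fun _ => norm_nonneg _) (fun k => ?_)
    ((Real.summable_pow_div_factorial (4 * ‖w‖)).mul_left (M * M'))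
  rw [norm_mul, norm_mul, norm_div, norm_pow, Complex.norm_natCast]
  calc _ ≤ ‖w‖ ^ k / (Nat.factorial k : ℝ) * ((M * 2 ^ k) * (M' * 2 ^ k)) := by
        gcongr
        · exact hx k
        · exact hy k
    _ = _ := by
        rw [mul_pow, show (4 : ℝ) = 2 * 2 by norm_num, mul_pow]
        ring

/-! ### Integration over the circle and Bessel's integral. -/

/-- Termwise integration of a power series with absolutely summable coefficients along a
unimodular function. -/
theorem hasSum_integral_pow_mul {a b : ℝ} {c : ℕ → ℂ} (hc : Summable fun k => ‖c k‖)
    {u G S : ℝ → ℂ} (hu : Continuous u) (hu1 : ∀ θ, ‖u θ‖ = 1) (hG : Continuous G)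
    (hS : ∀ θ, HasSum (fun k => c k * u θ ^ k) (S θ)) :
    HasSum (fun k => c k * ∫ θ in a..b, u θ ^ k * G θ) (∫ θ in a..b, S θ * G θ) := by
  simp only [← intervalIntegral.integral_const_mul]
  refine intervalIntegral.hasSum_integral_of_dominated_convergence
    (fun k θ => ‖c k‖ * ‖G θ‖) (fun k => ?_) (fun k => ?_) ?_ ?_ ?_
  · exact Continuous.aestronglyMeasurable (by fun_prop)
  · refine Filter.Eventually.of_forall fun θ _ => ?_
    simp [hu1]
  · exact Filter.Eventually.of_forall fun θ _ => hc.mul_right _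
  · simp only [tsum_mul_right]
    exact Continuous.intervalIntegrable (by fun_prop) _ _
  · refine Filter.Eventually.of_forall fun θ _ => ?_
    simpa only [mul_assoc] using (hS θ).mul_right (G θ)

/-- The parametrization `θ ↦ -e^{iθ}` of the unit circle. -/
noncomputable def negCircle (θ : ℝ) : ℂ := -Complex.exp (θ * Complex.I)

theorem continuous_negCircle : Continuous negCircle := by
  unfold negCircle; fun_prop

theorem negCircle_ne_zero (θ : ℝ) : negCircle θ ≠ 0 := neg_ne_zero.mpr (Complex.exp_ne_zero _)

theorem norm_negCircle (θ : ℝ) : ‖negCircle θ‖ = 1 := by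
  rw [negCircle, norm_neg, Complex.norm_exp_ofReal_mul_I]

theorem continuous_negCircle_zpow (r : ℤ) : Continuous fun θ => negCircle θ ^ r :=
  continuous_negCircle.zpow₀ r fun θ => Or.inl (negCircle_ne_zero θ)

theorem continuous_negCircle_inv : Continuous fun θ => (negCircle θ)⁻¹ :=
  continuous_negCircle.inv₀ negCircle_ne_zero

theorem negCircle_add_inv (θ : ℝ) :
    negCircle θ + (negCircle θ)⁻¹ = -(2 * (Real.cos θ : ℂ)) := by
  rw [negCircle, inv_neg, ← Complex.exp_neg, Complex.ofReal_cos, Complex.two_cos, neg_mul]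
  ring

theorem integral_negCircle_zpow (r : ℤ) :
    ∫ θ in (0 : ℝ)..(2 * Real.pi), negCircle θ ^ r = if r = 0 then 2 * (Real.pi : ℂ) else 0 := by
  split_ifs with hr
  · simp [hr]
  · have h : ∀ θ : ℝ, negCircle θ ^ r = (-1) ^ r * Complex.exp ((r * Complex.I) * θ) := by
      intro θ
      rw [negCircle, neg_eq_neg_one_mul, mul_zpow, ← Complex.exp_int_mul]
      ring_nf
    have hc : (r : ℂ) * Complex.I ≠ 0 :=
      mul_ne_zero (Int.cast_ne_zero.mpr hr) Complex.I_ne_zero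
    simp only [h, intervalIntegral.integral_const_mul]
    rw [integral_exp_mul_complex hc]
    have : Complex.exp ((r : ℂ) * Complex.I * ((2 * Real.pi : ℝ) : ℂ)) = 1 := by
      rw [← Complex.exp_int_mul_two_pi_mul_I r]
      push_cast
      ring_nf
    rw [this]
    simp

theorem summable_norm_pow_div_factorial (w : ℂ) :
    Summable fun k : ℕ => ‖w ^ k / (Nat.factorial k : ℂ)‖ := by
  simpa using Real.summable_pow_div_factorial ‖w‖

theorem hasSum_exp_mul (c v : ℂ) :
    HasSum (fun k => c ^ k / (Nat.factorial k : ℂ) * v ^ k) (Complex.exp (c * v)) := by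
  refine (hasSum_pow_div_factorial (c * v)).congr_fun fun k => ?_
  rw [mul_pow]
  ring

/-- Orthogonality of the powers of `u` leaves at most one term of the exponential series, and none
when `r < 0`. -/
theorem integral_exp_inv_mul_zpow (c : ℂ) (r : ℤ) :
    HasSum (fun k : ℕ => c ^ k / (Nat.factorial k : ℂ) *
        if (k : ℤ) = r then 2 * (Real.pi : ℂ) else 0)
      (∫ θ in (0 : ℝ)..(2 * Real.pi), Complex.exp (c * (negCircle θ)⁻¹) * negCircle θ ^ r) := by
  refine (hasSum_integral_pow_mul (summable_norm_pow_div_factorial c) continuous_negCircle_inv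
    (fun θ => by rw [norm_inv, norm_negCircle, inv_one]) (continuous_negCircle_zpow r)
    fun θ => hasSum_exp_mul c _).congr_fun fun k => ?_
  congr 1
  have : ∀ θ, (negCircle θ)⁻¹ ^ k * negCircle θ ^ r = negCircle θ ^ (r - k) := fun θ => by
    rw [zpow_sub₀ (negCircle_ne_zero θ), zpow_natCast, inv_pow, div_eq_mul_inv, mul_comm]
  simp only [this, integral_negCircle_zpow, sub_eq_zero, eq_comm]

theorem integral_exp_inv_mul_pow (c : ℂ) (r : ℕ) :
    ∫ θ in (0 : ℝ)..(2 * Real.pi), Complex.exp (c * (negCircle θ)⁻¹) * negCircle θ ^ (r : ℤ) =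
      c ^ r / (Nat.factorial r : ℂ) * (2 * Real.pi) := by
  refine (integral_exp_inv_mul_zpow c r).unique ?_
  convert hasSum_single r fun k hk => ?_ using 1
  · simp
  · simp [hk]

theorem integral_exp_inv_mul_zpow_neg (c : ℂ) {r : ℤ} (hr : r < 0) :
    ∫ θ in (0 : ℝ)..(2 * Real.pi), Complex.exp (c * (negCircle θ)⁻¹) * negCircle θ ^ r = 0 := by
  refine (integral_exp_inv_mul_zpow c r).unique ?_
  convert hasSum_zero using 1
  ext k
  rw [if_neg (by omega), mul_zero]

theorem hasSum_integral_bessel (c d : ℂ) (m : ℤ) :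
    HasSum (fun k : ℕ => c ^ k / (Nat.factorial k : ℂ) *
        ∫ θ in (0 : ℝ)..(2 * Real.pi),
          Complex.exp (d * (negCircle θ)⁻¹) * negCircle θ ^ ((k : ℤ) - m))
      (∫ θ in (0 : ℝ)..(2 * Real.pi), Complex.exp (c * negCircle θ) *
        (Complex.exp (d * (negCircle θ)⁻¹) * negCircle θ ^ (-m))) := by
  have hcont : Continuous fun θ =>
      Complex.exp (d * (negCircle θ)⁻¹) * negCircle θ ^ (-m) :=
    (Complex.continuous_exp.comp (continuous_const.mul continuous_negCircle_inv)).mul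
      (continuous_negCircle_zpow _)
  refine (hasSum_integral_pow_mul (summable_norm_pow_div_factorial c) continuous_negCircle
    norm_negCircle hcont fun θ => hasSum_exp_mul c _).congr_fun fun k => ?_
  congr 1
  refine intervalIntegral.integral_congr fun θ _ => ?_
  rw [sub_eq_add_neg, zpow_add₀ (negCircle_ne_zero θ), zpow_natCast]
  ring

theorem hasSum_besselJNat (m : ℕ) (z : ℝ) :
    HasSum (fun j : ℕ => (-1 : ℂ) ^ j / ((Nat.factorial j : ℂ) * (Nat.factorial (j + m) : ℂ)) *
      ((z : ℂ) / 2) ^ (2 * j + m)) (besselJNat m z : ℂ) := by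
  have := Complex.hasSum_ofReal.mpr (summable_besselJNat m z).hasSum
  refine this.congr_fun fun j => ?_
  push_cast
  rfl

/-- Bessel's integral, written on the circle. -/
theorem integral_eq_besselJ (m : ℤ) (z : ℝ) :
    ∫ θ in (0 : ℝ)..(2 * Real.pi), Complex.exp ((z : ℂ) / 2 * negCircle θ) *
      (Complex.exp (-((z : ℂ) / 2) * (negCircle θ)⁻¹) * negCircle θ ^ (-m)) =
    2 * Real.pi * (besselJ m z : ℂ) := by
  refine (hasSum_integral_bessel _ _ m).unique ?_
  rcases m with m | m
  · rw [← hasSum_nat_add_iff' m, Finset.sum_eq_zero, sub_zero]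
    · refine ((hasSum_besselJNat m z).mul_left (2 * (Real.pi : ℂ))).congr_fun fun j => ?_
      have : ((j + m : ℕ) : ℤ) - Int.ofNat m = (j : ℤ) := by simp
      rw [this, integral_exp_inv_mul_pow, neg_pow, two_mul j, pow_add, pow_add, pow_add]
      field_simp
    · intro i hi
      have := Finset.mem_range.mp hi
      rw [integral_exp_inv_mul_zpow_neg _ (by simp; omega), mul_zero]
  · simp only [besselJ]
    push_cast
    rw [mul_left_comm]
    refine (((hasSum_besselJNat (m + 1) z).mul_left (2 * (Real.pi : ℂ))).mul_left
      -- For negative order no term drops out, and `(-z/2)^(j+m+1)` supplies the sign `(-1)^(m+1)`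
      -- of `J_{-(m+1)}`.
      ((-1) ^ (m + 1))).congr_fun fun j => ?_
    have : (j : ℤ) - Int.negSucc m = ((j + (m + 1) : ℕ) : ℤ) := by
      rw [Int.negSucc_eq]; push_cast; ring
    rw [this, integral_exp_inv_mul_pow, neg_pow, two_mul j, pow_add, pow_add, pow_add _ (j + j)]
    field_simp
    ring

/-! ### Return to Laguerre polynomials and assembly. -/

theorem genLaguerre_eq_laguerreCoeff (n k : ℕ) (x : ℝ) :
    (genLaguerre n ((k : ℝ) - (n : ℝ)) x : ℂ) = laguerreCoeff n x k := by
  rw [laguerreCoeff_eq, Finset.Nat.sum_antidiagonal_eq_sum_range_succ_mk, genLaguerre,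
    add_sub_cancel, Complex.ofReal_sum]
  refine Finset.sum_congr rfl fun i _ => ?_
  rw [Ring.choose_natCast, neg_pow]
  push_cast
  ring

theorem laguerre_eq_sum (n : ℕ) (w x y : ℂ) (X : ℝ)
    (hX : w * X = -((w - x) * (w - y))) :
    (Nat.factorial n : ℂ) * ∑ q ∈ Finset.HasAntidiagonal.antidiagonal n, w ^ q.1 / (Nat.factorial q.1 : ℂ) *
        ((w - x) ^ q.2 / (Nat.factorial q.2 : ℂ)) * ((w - y) ^ q.2 / (Nat.factorial q.2 : ℂ)) =
      w ^ n * (laguerre n X : ℂ) := by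
  -- The sum is reversed so that `i` becomes the exponent of `(w-x)(w-y)`, matching `X^i`.
  rw [laguerre, genLaguerre, add_zero, Finset.Nat.sum_antidiagonal_eq_sum_range_succ_mk,
    ← Finset.sum_range_reflect]
  push_cast
  rw [Finset.mul_sum, Finset.mul_sum]
  refine Finset.sum_congr rfl fun i hi => ?_
  have hi' : i ≤ n := Nat.lt_succ_iff.mp (Finset.mem_range.mp hi)
  rw [Nat.sub_sub_self hi', Ring.choose_natCast]
  have e2 : w ^ n * (X : ℂ) ^ i = w ^ (n - i) * ((-1) ^ i * ((w - x) ^ i * (w - y) ^ i)) := by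
    rw [← mul_pow, ← mul_pow, neg_one_mul, ← hX, mul_pow, ← mul_assoc, ← pow_add,
      Nat.sub_add_cancel hi']
  rw [Nat.cast_choose ℂ (Nat.sub_le n i), Nat.sub_sub_self hi']
  have h1 : (-1 : ℂ) ^ i * (-1) ^ i = 1 := by rw [← mul_pow]; simp
  calc _ = (Nat.factorial n : ℂ) * (1 / (Nat.factorial (n - i) : ℂ)) *
        (1 / (Nat.factorial i : ℂ)) * (1 / (Nat.factorial i : ℂ)) *
        ((-1 : ℂ) ^ i * (-1) ^ i) * (w ^ (n - i) * ((w - x) ^ i * (w - y) ^ i)) := by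
        rw [h1]; ring
    _ = (Nat.factorial n : ℂ) * (1 / (Nat.factorial (n - i) : ℂ)) *
        (1 / (Nat.factorial i : ℂ)) * (1 / (Nat.factorial i : ℂ)) *
        (-1 : ℂ) ^ i * (w ^ n * (X : ℂ) ^ i) := by
        rw [e2]; ring
    _ = _ := by
        ring

theorem hasSum_laguerre_bessel (s t : ℝ) (n : ℕ) :
    HasSum (fun k : ℕ =>
      (s * t) ^ k / (Nat.factorial k : ℝ) *
        genLaguerre n ((k : ℝ) - (n : ℝ)) (s ^ 2) * genLaguerre n ((k : ℝ) - (n : ℝ)) (t ^ 2) *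
        besselJ ((k : ℤ) - (n : ℤ)) (s * t))
      ((s * t) ^ n / (Nat.factorial n : ℝ) * (1 / (2 * Real.pi) *
        ∫ θ in (0 : ℝ)..(2 * Real.pi), Real.exp (-(s * t * Real.cos θ)) *
          laguerre n (s ^ 2 + t ^ 2 + 2 * s * t * Real.cos θ))) := by
  set z : ℝ := s * t with hz
  have hn : (Nat.factorial n : ℂ) ≠ 0 := Nat.cast_ne_zero.mpr (Nat.factorial_ne_zero n)
  let G : ℝ → ℂ := fun θ => Complex.exp ((z : ℂ) / 2 * negCircle θ) *
      (Complex.exp (-((z : ℂ) / 2) * (negCircle θ)⁻¹) * negCircle θ ^ (n : ℤ))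
  have hG : Continuous G :=
    (Complex.continuous_exp.comp (continuous_const.mul continuous_negCircle)).mul
      ((Complex.continuous_exp.comp (continuous_const.mul continuous_negCircle_inv)).mul
        (continuous_negCircle_zpow _))
  have key := hasSum_integral_pow_mul (a := 0) (b := 2 * Real.pi)
    (summable_norm_laguerreCoeff_mul n z (s ^ 2 : ℝ) (t ^ 2 : ℝ)) continuous_negCircle_inv
    (fun θ => by rw [norm_inv, norm_negCircle, inv_one]) hG
    -- With `w = z/u`, the series in `k` is a power series in the unimodular `1/u`.
    fun θ => (hasSum_laguerreCoeff_mul n ((z : ℂ) * (negCircle θ)⁻¹) (s ^ 2 : ℝ)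
      (t ^ 2 : ℝ)).congr_fun fun k => by rw [mul_pow]; ring
  rw [← Complex.hasSum_ofReal]
  suffices h : (((z ^ n / (Nat.factorial n : ℝ) * (1 / (2 * Real.pi) *
        ∫ θ in (0 : ℝ)..(2 * Real.pi), Real.exp (-(z * Real.cos θ)) *
          laguerre n (s ^ 2 + t ^ 2 + 2 * s * t * Real.cos θ))) : ℝ) : ℂ) = _ by
    rw [h]
    refine (key.mul_left (1 / (2 * (Real.pi : ℂ)))).congr_fun fun k => ?_
    have : ∫ θ in (0 : ℝ)..(2 * Real.pi), (negCircle θ)⁻¹ ^ k * G θ =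
        2 * Real.pi * (besselJ ((k : ℤ) - n) z : ℂ) := by
      rw [← integral_eq_besselJ]
      refine intervalIntegral.integral_congr fun θ _ => ?_
      simp only [G]
      rw [neg_sub, zpow_sub₀ (negCircle_ne_zero θ), zpow_natCast _ k, inv_pow]
      ring
    rw [this]
    push_cast
    rw [genLaguerre_eq_laguerreCoeff, genLaguerre_eq_laguerreCoeff]
    push_cast
    field_simp
  · rw [Complex.ofReal_mul, Complex.ofReal_mul, mul_left_comm]
    push_cast
    congr 1
    rw [← intervalIntegral.integral_ofReal, ← intervalIntegral.integral_const_mul]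
    refine intervalIntegral.integral_congr fun θ _ => ?_
    simp only [G]
    have hu := negCircle_ne_zero θ
    have hadd := negCircle_add_inv θ
    have hL := laguerre_eq_sum n ((z : ℂ) * (negCircle θ)⁻¹) (s ^ 2 : ℝ) (t ^ 2 : ℝ)
      (s ^ 2 + t ^ 2 + 2 * s * t * Real.cos θ) (by
        have h2 : (2 : ℂ) * (Real.cos θ : ℂ) = -(negCircle θ + (negCircle θ)⁻¹) := by
          rw [hadd, neg_neg]
        push_cast at h2 ⊢
        rw [show (2 : ℂ) * s * t * Complex.cos θ = s * t * (2 * Complex.cos θ) by ring, h2, hz]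
        push_cast
        field_simp
        ring)
    have hE : Complex.exp ((z : ℂ) * (negCircle θ)⁻¹) *
        (Complex.exp ((z : ℂ) / 2 * negCircle θ) *
          Complex.exp (-((z : ℂ) / 2) * (negCircle θ)⁻¹)) =
        (Real.exp (-(z * Real.cos θ)) : ℂ) := by
      rw [← Complex.exp_add, ← Complex.exp_add, Complex.ofReal_exp]
      congr 1
      push_cast at hadd ⊢
      linear_combination (z : ℂ) / 2 * hadd
    rw [mul_pow] at hL
    have hu' : (negCircle θ)⁻¹ ^ n * negCircle θ ^ (n : ℤ) = 1 := by
      rw [zpow_natCast, ← mul_pow, inv_mul_cancel₀ hu, one_pow]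
    rw [mul_comm (Nat.factorial n : ℂ), ← eq_div_iff hn] at hL
    rw [← Complex.ofReal_pow s, ← Complex.ofReal_pow t, hL,
      Complex.ofReal_mul (Real.exp _), ← hE]
    linear_combination (-(Complex.exp ((z : ℂ) * (negCircle θ)⁻¹) *
        (Complex.exp ((z : ℂ) / 2 * negCircle θ) *
          Complex.exp (-((z : ℂ) / 2) * (negCircle θ)⁻¹)) * ((z : ℂ) ^ n / (Nat.factorial n : ℂ)) *
          (laguerre n (s ^ 2 + t ^ 2 + 2 * s * t * Real.cos θ) : ℂ))) * hu'

theorem mainTheorem2 (s t : ℝ) (hs : s ≠ 0) (ht : t ≠ 0) (n : ℕ) :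
    Summable (fun k : ℕ =>
      (s * t) ^ k / (Nat.factorial k : ℝ) *
        genLaguerre n ((k : ℝ) - (n : ℝ)) (s ^ 2) * genLaguerre n ((k : ℝ) - (n : ℝ)) (t ^ 2) *
        besselJ ((k : ℤ) - (n : ℤ)) (s * t)) ∧
    1 / (2 * Real.pi) * (∫ θ in (0 : ℝ)..(2 * Real.pi),
        Real.exp (-(s * t * Real.cos θ)) *
          laguerre n (s ^ 2 + t ^ 2 + 2 * s * t * Real.cos θ)) =
      (Nat.factorial n : ℝ) / (s * t) ^ n *
        ∑' k : ℕ, (s * t) ^ k / (Nat.factorial k : ℝ) *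
          genLaguerre n ((k : ℝ) - (n : ℝ)) (s ^ 2) * genLaguerre n ((k : ℝ) - (n : ℝ)) (t ^ 2) *
          besselJ ((k : ℤ) - (n : ℤ)) (s * t) := by

  have h := hasSum_laguerre_bessel s t n
  refine ⟨h.summable, ?_⟩
  rw [h.tsum_eq]
  have h1 : (s * t) ^ n ≠ 0 := pow_ne_zero _ (mul_ne_zero hs ht)
  have h2 : (Nat.factorial n : ℝ) ≠ 0 := Nat.cast_ne_zero.mpr (Nat.factorial_ne_zero n)
  field_simp
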